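/- **Setting.** Let $G$ be a Borel probability measure on $[0,\infty)$ and $\phi>0$. A configuration of obstacles is a countable family $\omega=\{(x_k,v_k)\}_{k\in I}$ (up to relabelling) with $x_k\in\mathbb R^3$ locally finite and $v_k\ge 0$; $\Omega$ is the set of configurations and $\Sigma$ is the $\sigma$-algebra generated by the counting variables $\omega\mapsto \#\{k:(x_k,v_k)\in A\}$, $A$ Borel. Let $\mu_\phi$ be the probability measure on $(\Omega,\Sigma)$ under which the centers form a Poisson process of intensity one in $\mathbb R^3$ and the volumes are independent with law $\frac1\phi G(\frac v\phi)\,dv$ (the law of $\phi v$ with $v\sim G$); equivalently, $\mu_\phi$ is the law of the Poisson process on $\mathbb R^3\times[0,\infty)$ whose intensity measure is the product of Lebesgue measure and this law. A tagged ball with center $X$ and volume $V$ is in contact with the obstacle $(x,v)$ if $|X-x|\le\sigma(V^{1/3}+v^{1/3})$, where $\sigma=(\frac{3}{4\pi})^{1/3}$. If the set $J$ of obstacles in contact is non-empty, a merging step replaces $$(X,V;\omega)\ \longmapsto\ \Big(\frac{VX+\sum_{k\in J}v_kx_k}{V+\sum_{k\in J}v_k},\ V+\sum_{k\in J}v_k;\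 \omega\setminus J\Big).$$ A coalescence event is a (possibly empty) sequence of consecutive merging steps, which are repeated as long as some remaining obstacle is in contact with the tagged ball. If it stops after finitely many steps, the tagged ball flies freely in the direction $e_1=(1,0,0)$ up to the first distance at which it comes into contact with a remaining obstacle (if there is one); it merges with the obstacle hit there, and then the next coalescence event begins. Let $m_j\in\mathbb N\cup\{\infty\}$, $j=1,2,\dots$, be the number of merging steps of the $j$-th coalescence event, for all $j$ for which this event is reached; the first event begins at the initial state. **Proposition.** Let $v_*\in\mathbb R$. There exists $\phi_*=\phi_*(v_*)>0$ such that for every probability measure $G$ with $\operatorname{supp}G\subset[0,v_*]$, every $0<\phi\le\phi_*$ and every $(Y_0,V_0)\in\mathbb R^3\times[0,\infty)$ there is a set $\Omega^*\in\Sigma$, $\Omega^*\subset\Omega$, with $\mu_\phi(\Omega^*)=1$ such that for every $\omega\in\Omega^*$ the dynamics started from the tagged ball with center $\phi^{1/3}Y_0$ and volume $\phi V_0$ in the configuration $\omega$ satisfies $m_j<\infty$ for every $j$ for which the $j$-th coalescence event is reached. -/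

import Mathlib

open MeasureTheory ProbabilityTheory
open scoped ENNReal NNReal

noncomputable section

namespace CTP

/-- Physical space `ℝ³` with its Euclidean norm. -/
abbrev Space := EuclideanSpace ℝ (Fin 3)

/-- An obstacle `(x, v)`: a ball with center `x` and volume `v`. -/
abbrev Obstacle := Space × ℝ

/-- The direction of motion `e₁ = (1, 0, 0)`. -/
def e₁ : Space := EuclideanSpace.single 0 1

/-- A countable family `{(x k, v k)}_{k ∈ I}`, `I ⊆ ℕ`, of obstacles with nonnegative volumes and
locally finite centers. It is recorded as the counting measure `∑_{k ∈ I} δ_{(x k, v k)}`, so two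
families are identified exactly when they differ by a relabelling of the indices. -/
def IsConfiguration (ω : Measure Obstacle) : Prop :=
  ∃ (I : Set ℕ) (x : ℕ → Space) (v : ℕ → ℝ),
    (∀ k ∈ I, 0 ≤ v k) ∧
    (∀ r : ℝ, {k ∈ I | ‖x k‖ ≤ r}.Finite) ∧
    ω = Measure.sum fun k : I => Measure.dirac (x k, v k)

/-- The configuration space `Ω`. It carries the σ-algebra `Σ` generated by the counting variables
`ω ↦ ω A` (number of obstacles in `A`), `A` measurable. -/
abbrev Configuration := {ω : Measure Obstacle // IsConfiguration ω}

/-- `μ` is the law on `Ω` of a Poisson point process with intensity measure `Λ`: the number of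
points in a measurable set of finite intensity `Λ A` is Poisson distributed with mean `Λ A`, and
the numbers of points in pairwise disjoint measurable sets are independent. -/
structure IsPoissonLaw (μ : Measure Configuration) (Λ : Measure Obstacle) : Prop where
  isProbabilityMeasure : IsProbabilityMeasure μ
  count : ∀ A : Set Obstacle, MeasurableSet A → Λ A ≠ ∞ → ∀ n : ℕ,
    μ {ω | ω.1 A = n} = poissonMeasure (Λ A).toNNReal {n}
  indep : ∀ A : ℕ → Set Obstacle, (∀ i, MeasurableSet (A i)) →
    Pairwise (fun i j => Disjoint (A i) (A j)) →
    iIndepFun (fun (i : ℕ) (ω : Configuration) => ω.1 (A i)) μ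

/-- Intensity of the background of obstacles: centers of intensity one with respect to Lebesgue
measure on `ℝ³`, and volumes independently distributed with law `φ⁻¹ G(v / φ) dv`, that is, the law
of `φ v` with `v` distributed according to `G`. -/
def obstacleIntensity (G : Measure ℝ) (φ : ℝ) : Measure Obstacle :=
  (volume : Measure Space).prod (G.map fun v => φ * v)

/-- State of the system: position and volume of the tagged particle, remaining obstacles. -/
structure State where
  pos : Space
  vol : ℝ
  obs : Measure Obstacle

/-- `σ = (3 / (4π))^{1/3}`; a ball of volume `V` has radius `σ V^{1/3}`. -/
def σ : ℝ := (3 / (4 * Real.pi)) ^ (1 / 3 : ℝ)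

namespace State

/-- Obstacles `(x, v)` which touch or overlap the tagged particle. -/
def contactRegion (s : State) : Set Obstacle :=
  {p | dist s.pos p.1 ≤ σ * (s.vol ^ (1 / 3 : ℝ) + p.2 ^ (1 / 3 : ℝ))}

/-- The group of obstacles (with multiplicity) in contact with the tagged particle. -/
def group (s : State) : Measure Obstacle := s.obs.restrict s.contactRegion

/-- Some obstacle is in contact with the tagged particle. -/
def InContact (s : State) : Prop := s.group ≠ 0

/-- One merging step: all obstacles of the contact group are absorbed at once. The volumes are
added, the new position is the center of mass, and the group is removed from the background.
Integrals against the counting measure `s.group` are sums over the group. -/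
def merge (s : State) : State where
  pos := (s.vol + ∫ p, p.2 ∂s.group)⁻¹ • (s.vol • s.pos + ∫ p, p.2 • p.1 ∂s.group)
  vol := s.vol + ∫ p, p.2 ∂s.group
  obs := s.obs.restrict s.contactRegionᶜ

/-- The number `m ∈ ℕ ∪ {∞}` of merging steps of the coalescence event which starts at `s`: merging
steps are performed as long as some obstacle is in contact with the tagged particle. -/
def stepCount (s : State) : ℕ∞ := ⨅ (n : ℕ) (_ : ¬ (merge^[n] s).InContact), (n : ℕ∞)

/-- Free flight over the distance `l` in the direction `e₁`. -/
def advance (s : State) (l : ℝ) : State := { s with pos := s.pos + l • e₁ }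

/-- `l` is the length of the free flight which starts at `s`: the first distance at which an
obstacle comes into contact with the tagged particle. -/
def IsFlightLength (s : State) (l : ℝ) : Prop :=
  IsLeast {l : ℝ | 0 ≤ l ∧ (s.advance l).InContact} l

/-- `EventStart s₀ j s`: in the dynamics started from `s₀`, the `j`-th coalescence event (counted
from `0`) is reached, and `s` is the state at its beginning. The initial event begins at `s₀`; if
the `j`-th event stops after finitely many steps `n`, then a free flight follows, the obstacles hit
at its end are merged, and the next (possibly empty) coalescence event begins. -/
inductive EventStart (s₀ : State) : ℕ → State → Prop
  | first : EventStart s₀ 0 s₀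
  | next {j : ℕ} {s : State} {n : ℕ} {l : ℝ} : EventStart s₀ j s → s.stepCount = n →
      (merge^[n] s).IsFlightLength l →
      EventStart s₀ (j + 1) ((merge^[n] s).advance l).merge

end State

/-- Initial state with rescaled position `Y₀` and rescaled volume `V₀`: the tagged particle has
position `φ^{1/3} Y₀` and volume `φ V₀`. -/
def initialState (φ : ℝ) (Y₀ : Space) (V₀ : ℝ) (ω : Configuration) : State where
  pos := φ ^ (1 / 3 : ℝ) • Y₀
  vol := φ * V₀
  obs := ω.1

end CTP

end

namespace CTP

/-! The heart is a deterministic volume bound. One merging step moves the center by at most 6σ times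
the increase of V^{1/3}, which telescopes (`norm_merge_pos_le`). Hence everything absorbed in n
steps from (X, V) lies within |X| + 8σ V_n^{1/3} of the origin. If a ball of radius R holds at most
K(a + R)³ obstacles, each of volume at most M, this gives V_n ≤ V + MK(a + |X| + 8σ V_n^{1/3})³. For
small MK the V_n on the right is absorbed by the left (`merge_iterate_vol_le`), so V_n stays
bounded, only finitely many obstacles are within reach, and every step uses up at least one
(`stepCount_lt_top`).

The smallness condition involves neither a nor the current state, so it serves all events at once.
Almost surely the bound holds with K independent of φ and G and with a random a, by a Chernoff bound
and Borel–Cantelli (`ae_sparse`); φ enters only through M = φ|v_*|. -/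

/-- A background whose obstacles have volumes in `[0, M]`, whose number of centers within distance
`R` of the origin is at most `K (a + R)³`, and which charges no set with mass in `(0, 1)`. -/
structure Sparse (ω : Measure Obstacle) (M K a : ℝ) : Prop where
  vol_mem : ∀ᵐ p ∂ω, p.2 ∈ Set.Icc 0 M
  count_le : ∀ R : ℝ, 0 ≤ R → ω {p | ‖p.1‖ ≤ R} ≤ ENNReal.ofReal (K * (a + R) ^ 3)
  one_le : ∀ A : Set Obstacle, MeasurableSet A → ω A ≠ 0 → 1 ≤ ω A

theorem Sparse.restrict {ω : Measure Obstacle} {M K a : ℝ} (h : Sparse ω M K a)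
    {S : Set Obstacle} (hS : MeasurableSet S) : Sparse (ω.restrict S) M K a where
  vol_mem := ae_restrict_of_ae h.vol_mem
  count_le R hR := (Measure.restrict_apply_le S _).trans (h.count_le R hR)
  one_le A hA hne := by
    rw [Measure.restrict_apply hA] at hne ⊢
    exact h.one_le _ (hA.inter hS) hne

theorem σ_nonneg : 0 ≤ σ := by unfold σ; positivity

/-- Turns a gain in volume into a gain in radius. -/
theorem cube_sub_cube_le {x y : ℝ} (hx : 0 ≤ x) (hxy : x ≤ y) :
    y ^ 3 - x ^ 3 ≤ 3 * y ^ 2 * (y - x) := by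
  have h := sq_nonneg (y - x)
  nlinarith [mul_nonneg h hx, mul_nonneg h (hx.trans hxy)]

theorem rpow_third_cube {V : ℝ} (hV : 0 ≤ V) : (V ^ (1 / 3 : ℝ)) ^ 3 = V := by
  rw [← Real.rpow_natCast, ← Real.rpow_mul hV]; norm_num

/-! ### One merging step -/

namespace State

theorem measurableSet_contactRegion (s : State) : MeasurableSet s.contactRegion := by
  unfold contactRegion
  apply measurableSet_le
  · fun_prop
  · fun_prop

/-- The volume absorbed in one merging step. -/
noncomputable def absorbed (s : State) : ℝ := ∫ p, p.2 ∂s.group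

theorem merge_vol (s : State) : s.merge.vol = s.vol + s.absorbed := rfl

variable {s : State} {M K a : ℝ}

theorem group_sparse (h : Sparse s.obs M K a) : Sparse s.group M K a :=
  h.restrict s.measurableSet_contactRegion

theorem merge_sparse (h : Sparse s.obs M K a) : Sparse s.merge.obs M K a :=
  h.restrict s.measurableSet_contactRegion.compl

theorem ae_mem_contactRegion (s : State) : ∀ᵐ p ∂s.group, p ∈ s.contactRegion :=
  ae_restrict_mem s.measurableSet_contactRegion

theorem obs_eq_group_add (s : State) : s.obs = s.group + s.merge.obs :=
  (Measure.restrict_add_restrict_compl s.measurableSet_contactRegion).symm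

theorem group_norm_le (h : Sparse s.obs M K a) :
    ∀ᵐ p ∂s.group, ‖p.1‖ ≤ ‖s.pos‖ + σ * (s.vol ^ (1 / 3 : ℝ) + M ^ (1 / 3 : ℝ)) := by
  filter_upwards [s.ae_mem_contactRegion, (group_sparse h).vol_mem] with p hp hv
  have h1 : p.2 ^ (1 / 3 : ℝ) ≤ M ^ (1 / 3 : ℝ) :=
    Real.rpow_le_rpow hv.1 hv.2 (by norm_num)
  have h2 : ‖p.1‖ ≤ ‖s.pos‖ + dist s.pos p.1 := by
    rw [dist_eq_norm]; exact norm_le_norm_add_norm_sub _ _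
  have h3 := mul_le_mul_of_nonneg_left h1 σ_nonneg
  have h4 : dist s.pos p.1 ≤ _ := hp
  linarith

theorem isFiniteMeasure_group (h : Sparse s.obs M K a) : IsFiniteMeasure s.group := by
  constructor
  set R := max 0 (‖s.pos‖ + σ * (s.vol ^ (1 / 3 : ℝ) + M ^ (1 / 3 : ℝ)))
  refine lt_of_le_of_lt ?_ (((group_sparse h).count_le R (le_max_left _ _)).trans_lt
    ENNReal.ofReal_lt_top)
  refine measure_mono_ae ?_
  filter_upwards [group_norm_le h] with p hp _
  exact hp.trans (le_max_right _ _)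

theorem integrable_vol (h : Sparse s.obs M K a) : Integrable (fun p : Obstacle => p.2) s.group := by
  have := isFiniteMeasure_group h
  refine Integrable.of_bound (by fun_prop) M ?_
  filter_upwards [(group_sparse h).vol_mem] with p hp
  rw [Real.norm_of_nonneg hp.1]
  exact hp.2

theorem integrable_moment (h : Sparse s.obs M K a) :
    Integrable (fun p : Obstacle => p.2 • p.1) s.group := by
  have := isFiniteMeasure_group h
  refine Integrable.of_bound (C := M * (‖s.pos‖ + σ * (s.vol ^ (1 / 3 : ℝ) + M ^ (1 / 3 : ℝ))))
    (Measurable.aestronglyMeasurable (by fun_prop)) ?_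
  filter_upwards [(group_sparse h).vol_mem, group_norm_le h] with p hp hn
  rw [norm_smul, Real.norm_of_nonneg hp.1]
  exact mul_le_mul hp.2 hn (norm_nonneg _) (hp.1.trans hp.2)

theorem absorbed_nonneg (h : Sparse s.obs M K a) : 0 ≤ s.absorbed :=
  integral_nonneg_of_ae ((group_sparse h).vol_mem.mono fun _ hp => hp.1)

theorem absorbed_le (h : Sparse s.obs M K a) : s.absorbed ≤ M * s.group.real Set.univ := by
  have := isFiniteMeasure_group h
  have := integral_mono_ae (integrable_vol h) (integrable_const M)
    ((group_sparse h).vol_mem.mono fun _ hp => hp.2)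
  rw [integral_const, smul_eq_mul, mul_comm] at this
  exact this

/-- Each absorbed obstacle has at most the total absorbed volume. -/
theorem group_vol_le_absorbed (h : Sparse s.obs M K a) : ∀ᵐ p ∂s.group, p.2 ≤ s.absorbed := by
  have := isFiniteMeasure_group h
  have hD := absorbed_nonneg h
  -- A non-null set has mass at least 1, so Markov's inequality at a level strictly above the total
  -- is contradictory; the slack supplies the strictness.
  have key : ∀ n : ℕ, ∀ᵐ p ∂s.group, p.2 < s.absorbed + 1 / ((n : ℝ) + 1) := by
    intro n
    have he : (0 : ℝ) < 1 / ((n : ℝ) + 1) := by positivity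
    have markov := mul_meas_ge_le_integral_of_nonneg
      ((group_sparse h).vol_mem.mono fun _ hp => hp.1) (integrable_vol h)
      (s.absorbed + 1 / ((n : ℝ) + 1))
    rw [ae_iff]
    simp only [not_lt]
    by_contra hne
    have h1 := (group_sparse h).one_le _ (measurableSet_le measurable_const measurable_snd) hne
    have h2 : 1 ≤ s.group.real {p : Obstacle | s.absorbed + 1 / ((n : ℝ) + 1) ≤ p.2} := by
      rw [Measure.real, ← ENNReal.toReal_one]
      exact ENNReal.toReal_mono (measure_ne_top _ _) h1
    have h3 : (s.absorbed + 1 / ((n : ℝ) + 1)) *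
      s.group.real {p : Obstacle | s.absorbed + 1 / ((n : ℝ) + 1) ≤ p.2} ≤ s.absorbed := markov
    nlinarith
  filter_upwards [ae_all_iff.2 key] with p hp
  refine ge_of_tendsto' (x := Filter.atTop)
    (f := fun n : ℕ => s.absorbed + 1 / ((n : ℝ) + 1)) ?_ fun n => (hp n).le
  simpa using tendsto_one_div_add_atTop_nhds_zero_nat.const_add s.absorbed

/-- The tagged ball and each absorbed obstacle have volume at most that of the merged ball, so the
merged radius bounds both radii. -/
theorem group_dist_le (h : Sparse s.obs M K a) (hV : 0 ≤ s.vol) :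
    ∀ᵐ p ∂s.group, ‖p.1 - s.pos‖ ≤ 2 * σ * s.merge.vol ^ (1 / 3 : ℝ) := by
  have hD := absorbed_nonneg h
  filter_upwards [s.ae_mem_contactRegion, (group_sparse h).vol_mem, group_vol_le_absorbed h]
    with p hp hv hd
  have h1 : p.2 ^ (1 / 3 : ℝ) ≤ s.merge.vol ^ (1 / 3 : ℝ) :=
    Real.rpow_le_rpow hv.1 (by rw [merge_vol]; linarith) (by norm_num)
  have h2 : s.vol ^ (1 / 3 : ℝ) ≤ s.merge.vol ^ (1 / 3 : ℝ) :=
    Real.rpow_le_rpow hV (by rw [merge_vol]; linarith) (by norm_num)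
  have h3 : dist s.pos p.1 ≤ _ := hp
  rw [dist_comm, dist_eq_norm] at h3
  have h4 := mul_le_mul_of_nonneg_left (add_le_add h2 h1) σ_nonneg
  linarith

/-- With x, y the cube roots of the old and new volume, the center of mass moves by at most 2σy ·
(y³ − x³)/y³ ≤ 6σ(y − x). -/
theorem norm_merge_pos_le (h : Sparse s.obs M K a) (hV : 0 ≤ s.vol) :
    ‖s.merge.pos‖ ≤ ‖s.pos‖ +
      6 * σ * (s.merge.vol ^ (1 / 3 : ℝ) - s.vol ^ (1 / 3 : ℝ)) := by
  have hfin := isFiniteMeasure_group h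
  have hD := absorbed_nonneg h
  have hW : 0 ≤ s.merge.vol := by rw [merge_vol]; linarith
  have hxy : s.vol ^ (1 / 3 : ℝ) ≤ s.merge.vol ^ (1 / 3 : ℝ) :=
    Real.rpow_le_rpow hV (by rw [merge_vol]; linarith) (by norm_num)
  have hσ := σ_nonneg
  have hpos : s.merge.pos = s.merge.vol⁻¹ • (s.vol • s.pos + ∫ p, p.2 • p.1 ∂s.group) := rfl
  -- At total volume zero the inverse is 0 by convention and the new center is the origin, which is
  -- harmless for a bound on the norm.
  rcases hW.eq_or_lt with h0 | hW
  · rw [hpos, ← h0, inv_zero, zero_smul, norm_zero]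
    rw [← h0] at hxy
    have := mul_nonneg hσ (sub_nonneg.2 hxy)
    have := norm_nonneg s.pos
    linarith
  have hcm : s.merge.vol • (s.merge.pos - s.pos) = ∫ p, p.2 • (p.1 - s.pos) ∂s.group := by
    have : ∫ p, p.2 • (p.1 - s.pos) ∂s.group
        = (∫ p, p.2 • p.1 ∂s.group) - s.absorbed • s.pos := by
      simp_rw [smul_sub]
      rw [integral_sub (integrable_moment h) ((integrable_vol h).smul_const _),
        integral_smul_const]
      rfl
    rw [this, smul_sub, hpos, smul_inv_smul₀ hW.ne', merge_vol, add_smul]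
    abel
  have hnorm : ‖∫ p, p.2 • (p.1 - s.pos) ∂s.group‖
      ≤ ∫ p, p.2 * (2 * σ * s.merge.vol ^ (1 / 3 : ℝ)) ∂s.group := by
    refine norm_integral_le_of_norm_le ((integrable_vol h).mul_const _) ?_
    filter_upwards [(group_sparse h).vol_mem, group_dist_le h hV] with p hv hd
    rw [norm_smul, Real.norm_of_nonneg hv.1]
    exact mul_le_mul_of_nonneg_left hd hv.1
  rw [← hcm, norm_smul, Real.norm_of_nonneg hW.le, integral_mul_const] at hnorm
  change _ ≤ s.absorbed * _ at hnorm
  have hx3 := rpow_third_cube hV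
  have hy3 := rpow_third_cube hW.le
  have hx := Real.rpow_nonneg hV (1 / 3 : ℝ)
  have hy := Real.rpow_pos_of_pos hW (1 / 3 : ℝ)
  have hDe : s.absorbed = s.merge.vol - s.vol := by rw [merge_vol]; ring
  have htri : ‖s.merge.pos‖ ≤ ‖s.pos‖ + ‖s.merge.pos - s.pos‖ := by
    have := norm_add_le s.pos (s.merge.pos - s.pos)
    rwa [add_sub_cancel] at this
  refine htri.trans (add_le_add_right ?_ _)
  set x := s.vol ^ (1 / 3 : ℝ)
  set y := s.merge.vol ^ (1 / 3 : ℝ)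
  rw [hDe, ← hx3, ← hy3] at hnorm
  have hc := mul_le_mul_of_nonneg_left (cube_sub_cube_le hx hxy)
    (by positivity : 0 ≤ 2 * σ * y)
  refine le_of_mul_le_mul_left ?_ (pow_pos hy 3)
  nlinarith

/-! ### Iterated merging and the volume bound -/

theorem merge_iterate_sparse (h : Sparse s.obs M K a) (n : ℕ) :
    Sparse (merge^[n] s).obs M K a := by
  induction n with
  | zero => exact h
  | succ n ih => rw [Function.iterate_succ_apply']; exact merge_sparse ih

theorem merge_iterate_vol_nonneg (h : Sparse s.obs M K a) (hV : 0 ≤ s.vol) (n : ℕ) :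
    0 ≤ (merge^[n] s).vol := by
  induction n with
  | zero => exact hV
  | succ n ih =>
    rw [Function.iterate_succ_apply', merge_vol]
    exact add_nonneg ih (absorbed_nonneg (merge_iterate_sparse h n))

theorem merge_iterate_vol_mono (h : Sparse s.obs M K a) :
    Monotone fun n => (merge^[n] s).vol := by
  refine monotone_nat_of_le_succ fun n => ?_
  rw [Function.iterate_succ_apply', merge_vol]
  exact le_add_of_nonneg_right (absorbed_nonneg (merge_iterate_sparse h n))

theorem merge_iterate_norm_pos_le (h : Sparse s.obs M K a) (hV : 0 ≤ s.vol) (n : ℕ) :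
    ‖(merge^[n] s).pos‖ ≤ ‖s.pos‖ + 6 * σ * (merge^[n] s).vol ^ (1 / 3 : ℝ) := by
  suffices ‖(merge^[n] s).pos‖ ≤ ‖s.pos‖ +
      6 * σ * ((merge^[n] s).vol ^ (1 / 3 : ℝ) - s.vol ^ (1 / 3 : ℝ)) by
    have := mul_nonneg σ_nonneg (Real.rpow_nonneg hV (1 / 3 : ℝ))
    linarith
  induction n with
  | zero => simp
  | succ n ih =>
    rw [Function.iterate_succ_apply']
    have := norm_merge_pos_le (merge_iterate_sparse h n) (merge_iterate_vol_nonneg h hV n)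
    linarith

/-- Each group leaves the background when absorbed, so no obstacle is counted twice. -/
theorem obs_eq_sum_group_add (s : State) (n : ℕ) :
    s.obs = ∑ i ∈ Finset.range n, (merge^[i] s).group + (merge^[n] s).obs := by
  induction n with
  | zero => simp
  | succ n ih =>
    rw [Finset.sum_range_succ, add_assoc, Function.iterate_succ_apply', ← obs_eq_group_add]
    exact ih

theorem sum_group_le (s : State) (n : ℕ) (A : Set Obstacle) :
    ∑ i ∈ Finset.range n, (merge^[i] s).group A ≤ s.obs A := by
  conv_rhs => rw [obs_eq_sum_group_add s n]
  rw [Measure.add_apply, Measure.finsetSum_apply]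
  exact le_self_add

/-- The obstacles absorbed in a merging step lie in a ball whose radius is controlled by the
volume of the tagged particle after that step. -/
theorem group_iterate_univ_eq (h : Sparse s.obs M K a) (hV : 0 ≤ s.vol) {i : ℕ} {R : ℝ}
    (hR : ‖s.pos‖ + 8 * σ * (merge^[i + 1] s).vol ^ (1 / 3 : ℝ) ≤ R) :
    (merge^[i] s).group {p | ‖p.1‖ ≤ R} = (merge^[i] s).group Set.univ := by
  refine measure_congr (Filter.eventuallyEq_univ.2 ?_)
  have hi := merge_iterate_sparse h i
  have hVi := merge_iterate_vol_nonneg h hV i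
  -- The 8σ is 6σ for the drift of the center plus 2σ for the reach of the step.
  filter_upwards [group_dist_le hi hVi] with p hp
  have h1 := merge_iterate_norm_pos_le h hV i
  have h2 : (merge^[i] s).vol ^ (1 / 3 : ℝ) ≤ (merge^[i + 1] s).vol ^ (1 / 3 : ℝ) :=
    Real.rpow_le_rpow hVi (merge_iterate_vol_mono h i.le_succ) (by norm_num)
  rw [← Function.iterate_succ_apply' merge i s] at hp
  have h3 : ‖p.1‖ ≤ ‖(merge^[i] s).pos‖ + ‖p.1 - (merge^[i] s).pos‖ := by
    have := norm_add_le (merge^[i] s).pos (p.1 - (merge^[i] s).pos)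
    rwa [add_sub_cancel] at this
  have h4 := mul_le_mul_of_nonneg_left h2 σ_nonneg
  change ‖p.1‖ ≤ R
  linarith

theorem merge_iterate_vol_eq (s : State) (n : ℕ) :
    (merge^[n] s).vol = s.vol + ∑ i ∈ Finset.range n, (merge^[i] s).absorbed := by
  induction n with
  | zero => simp
  | succ n ih => rw [Function.iterate_succ_apply', merge_vol, ih, Finset.sum_range_succ, add_assoc]

theorem sum_group_univ_le (h : Sparse s.obs M K a) (hV : 0 ≤ s.vol) {n : ℕ} {R : ℝ}
    (hR : ‖s.pos‖ + 8 * σ * (merge^[n] s).vol ^ (1 / 3 : ℝ) ≤ R) :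
    ∑ i ∈ Finset.range n, (merge^[i] s).group Set.univ ≤ ENNReal.ofReal (K * (a + R) ^ 3) := by
  have hR0 : 0 ≤ R := le_trans (by
    have := mul_nonneg σ_nonneg
      (Real.rpow_nonneg (merge_iterate_vol_nonneg h hV n) (1 / 3 : ℝ))
    have := norm_nonneg s.pos
    linarith) hR
  rw [Finset.sum_congr rfl fun i hi => (group_iterate_univ_eq h hV (R := R) ?_).symm]
  · exact (sum_group_le s n _).trans (h.count_le R hR0)
  · refine le_trans ?_ hR
    have h2 : (merge^[i + 1] s).vol ^ (1 / 3 : ℝ) ≤ (merge^[n] s).vol ^ (1 / 3 : ℝ) :=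
      Real.rpow_le_rpow (merge_iterate_vol_nonneg h hV _)
        (merge_iterate_vol_mono h (Finset.mem_range.1 hi)) (by norm_num)
    have h4 := mul_le_mul_of_nonneg_left h2 σ_nonneg
    linarith

theorem merge_iterate_vol_le (h : Sparse s.obs M K a) (hV : 0 ≤ s.vol) (hM : 0 ≤ M) (hK : 0 ≤ K)
    (ha : 0 ≤ a) (hsmall : 4096 * M * K * σ ^ 3 ≤ 1) (n : ℕ) :
    (merge^[n] s).vol ≤ 2 * (s.vol + 4 * M * K * (a + ‖s.pos‖) ^ 3) := by
  have hVn := merge_iterate_vol_nonneg h hV n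
  set y := (merge^[n] s).vol ^ (1 / 3 : ℝ) with hy
  have hy3 : y ^ 3 = (merge^[n] s).vol := rpow_third_cube hVn
  have hy0 : 0 ≤ y := Real.rpow_nonneg hVn _
  have hσ := σ_nonneg
  have hsum : ∑ i ∈ Finset.range n, (merge^[i] s).group.real Set.univ
      ≤ K * (a + (‖s.pos‖ + 8 * σ * y)) ^ 3 := by
    have := sum_group_univ_le h hV (n := n) le_rfl
    have h2 := ENNReal.toReal_mono ENNReal.ofReal_ne_top this
    rw [ENNReal.toReal_ofReal (by positivity), ENNReal.toReal_sum] at h2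
    · exact h2
    · intro i _
      have := isFiniteMeasure_group (merge_iterate_sparse h i)
      exact measure_ne_top _ _
  have habs : ∑ i ∈ Finset.range n, (merge^[i] s).absorbed
      ≤ M * ∑ i ∈ Finset.range n, (merge^[i] s).group.real Set.univ := by
    rw [Finset.mul_sum]
    exact Finset.sum_le_sum fun i _ => absorbed_le (merge_iterate_sparse h i)
  have hvol := merge_iterate_vol_eq s n
  have hb : 0 ≤ a + ‖s.pos‖ := by positivity
  have hcube : (a + (‖s.pos‖ + 8 * σ * y)) ^ 3
      ≤ 4 * ((a + ‖s.pos‖) ^ 3 + (8 * σ * y) ^ 3) := by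
    rw [← add_assoc]
    exact (add_pow_le hb (by positivity) 3).trans_eq (by norm_num)
  have h1 : ∑ i ∈ Finset.range n, (merge^[i] s).absorbed
      ≤ M * (K * (4 * ((a + ‖s.pos‖) ^ 3 + (8 * σ * y) ^ 3))) := by
    refine habs.trans (mul_le_mul_of_nonneg_left (hsum.trans ?_) hM)
    exact mul_le_mul_of_nonneg_left hcube hK
  -- Since 4 · 8³ = 2048, `hsmall` makes the coefficient of the final volume at most 1/2.
  have h2 : M * (K * (4 * ((a + ‖s.pos‖) ^ 3 + (8 * σ * y) ^ 3)))
      = 4 * M * K * (a + ‖s.pos‖) ^ 3 + 4096 * M * K * σ ^ 3 * (merge^[n] s).vol / 2 := by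
    rw [← hy3]; ring
  have h3 := mul_le_mul_of_nonneg_right hsmall hVn
  linarith

/-- In a sufficiently sparse background every coalescence event is finite. -/
theorem stepCount_lt_top (h : Sparse s.obs M K a) (hV : 0 ≤ s.vol) (hM : 0 ≤ M) (hK : 0 ≤ K)
    (ha : 0 ≤ a) (hsmall : 4096 * M * K * σ ^ 3 ≤ 1) : s.stepCount < ⊤ := by
  by_contra htop
  have hcontact : ∀ n, (merge^[n] s).InContact := by
    intro n
    by_contra hn
    exact htop ((iInf₂_le n hn).trans_lt (ENat.natCast_lt_top n))
  set W := 2 * (s.vol + 4 * M * K * (a + ‖s.pos‖) ^ 3)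
  set R := ‖s.pos‖ + 8 * σ * W ^ (1 / 3 : ℝ)
  -- Each of n steps absorbs mass at least 1 from one fixed ball of radius R.
  have hbound : ∀ n : ℕ, (n : ℝ≥0∞) ≤ ENNReal.ofReal (K * (a + R) ^ 3) := by
    intro n
    refine le_trans ?_ (sum_group_univ_le h hV (n := n) (R := R) ?_)
    · calc (n : ℝ≥0∞) = ∑ i ∈ Finset.range n, 1 := by simp
        _ ≤ _ := Finset.sum_le_sum fun i _ =>
          (group_sparse (merge_iterate_sparse h i)).one_le _ MeasurableSet.univ
            (Measure.measure_univ_ne_zero.2 (hcontact i))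
    · have h2 : (merge^[n] s).vol ^ (1 / 3 : ℝ) ≤ W ^ (1 / 3 : ℝ) :=
        Real.rpow_le_rpow (merge_iterate_vol_nonneg h hV _)
          (merge_iterate_vol_le h hV hM hK ha hsmall n) (by norm_num)
      have h4 := mul_le_mul_of_nonneg_left h2 σ_nonneg
      simp only [R]
      linarith
  obtain ⟨n, hn⟩ := ENNReal.exists_nat_gt
    (ENNReal.ofReal_ne_top : ENNReal.ofReal (K * (a + R) ^ 3) ≠ ∞)
  exact absurd (hbound n) (not_le.2 hn)

/-- Merging only removes obstacles and flight only moves the center, so the constants survive all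
events. -/
theorem EventStart.sparse {s₀ : State} (h : Sparse s₀.obs M K a) (hV : 0 ≤ s₀.vol) {j : ℕ}
    {s : State} (hs : EventStart s₀ j s) : Sparse s.obs M K a ∧ 0 ≤ s.vol := by
  induction hs with
  | first => exact ⟨h, hV⟩
  | @next j s n l _ _ _ ih =>
    have h1 : Sparse ((merge^[n] s).advance l).obs M K a := merge_iterate_sparse ih.1 n
    refine ⟨merge_sparse h1, ?_⟩
    rw [merge_vol]
    exact add_nonneg (merge_iterate_vol_nonneg ih.1 ih.2 n) (absorbed_nonneg h1)

end State

/-! ### Poisson counts -/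

theorem IsConfiguration.one_le {ω : Measure Obstacle} (h : IsConfiguration ω) {A : Set Obstacle}
    (hA : MeasurableSet A) (hne : ω A ≠ 0) : 1 ≤ ω A := by
  obtain ⟨I, x, v, -, -, rfl⟩ := h
  rw [Measure.sum_apply _ hA] at hne ⊢
  obtain ⟨k, hk⟩ : ∃ k : I, Measure.dirac (x k, v k) A ≠ 0 := by
    by_contra! hall
    exact hne (ENNReal.tsum_eq_zero.2 hall)
  refine le_trans ?_ (ENNReal.le_tsum k)
  rw [Measure.dirac_apply' _ hA] at hk ⊢
  rw [Set.indicator_of_mem (Set.mem_of_indicator_ne_zero hk), Pi.one_apply]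

theorem measurable_count {A : Set Obstacle} (hA : MeasurableSet A) :
    Measurable fun ω : Configuration => ω.1 A :=
  (Measure.measurable_coe hA).comp measurable_subtype_coe

/-- Chernoff bound for the Poisson distribution at three times its mean. -/
theorem tsum_poisson_tail_le (r : ℝ≥0) :
    ∑' n : ℕ, (if 3 * (r : ℝ) < n then poissonMeasure r {n} else 0)
      ≤ ENNReal.ofReal (Real.exp (-r)) := by
  have hsum : HasSum (fun n : ℕ => Real.exp (-(4 * r)) * ((Real.exp 1 * r) ^ n / n.factorial))
      (Real.exp (-(4 * r)) * Real.exp (Real.exp 1 * r)) := by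
    rw [Real.exp_eq_exp_ℝ]
    exact (NormedSpace.expSeries_div_hasSum_exp (NormedSpace.exp (1 : ℝ) * (r : ℝ))).mul_left _
  calc ∑' n : ℕ, (if 3 * (r : ℝ) < n then poissonMeasure r {n} else 0)
      ≤ ∑' n : ℕ, ENNReal.ofReal
          (Real.exp (-(4 * r)) * ((Real.exp 1 * r) ^ n / n.factorial)) := by
        refine ENNReal.tsum_le_tsum fun n => ?_
        split_ifs with hn
        · rw [poissonMeasure_singleton]
          refine ENNReal.ofReal_le_ofReal ?_
          -- Exponential tilt: e^{n − 3r} ≥ 1 when n > 3r.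
          have h1 : Real.exp (-r) ≤ Real.exp (-(4 * r)) * Real.exp 1 ^ n := by
            rw [← Real.exp_nat_mul, ← Real.exp_add]
            exact Real.exp_le_exp.2 (by linarith)
          have h2 : (0 : ℝ) ≤ r ^ n / n.factorial := by positivity
          calc Real.exp (-r) * r ^ n / n.factorial = Real.exp (-r) * (r ^ n / n.factorial) := by ring
            _ ≤ Real.exp (-(4 * r)) * Real.exp 1 ^ n * (r ^ n / n.factorial) :=
              mul_le_mul_of_nonneg_right h1 h2
            _ = _ := by rw [mul_pow]; ring
        · exact zero_le
    _ = ENNReal.ofReal (Real.exp (-(4 * r)) * Real.exp (Real.exp 1 * r)) := by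
        rw [← ENNReal.ofReal_tsum_of_nonneg (fun n => by positivity) hsum.summable, hsum.tsum_eq]
    _ ≤ _ := by
        refine ENNReal.ofReal_le_ofReal ?_
        rw [← Real.exp_add]
        refine Real.exp_le_exp.2 ?_
        have := mul_le_mul_of_nonneg_right Real.exp_one_lt_three.le r.2
        change Real.exp 1 * (r : ℝ) ≤ 3 * r at this
        linarith

section Poisson

variable {μ : Measure Configuration} {Λ : Measure Obstacle}

/-- The Poisson weights of the finite values already sum to 1. -/
theorem IsPoissonLaw.ae_exists_count_eq (h : IsPoissonLaw μ Λ) {A : Set Obstacle}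
    (hA : MeasurableSet A) (hΛ : Λ A ≠ ∞) :
    ∀ᵐ ω : Configuration ∂μ, ∃ n : ℕ, ω.1 A = (n : ℝ≥0∞) := by
  have := h.isProbabilityMeasure
  have hm : ∀ n : ℕ, MeasurableSet {ω : Configuration | ω.1 A = (n : ℝ≥0∞)} := fun n =>
    measurable_count hA (measurableSet_singleton _)
  have hset : {ω : Configuration | ∃ n : ℕ, ω.1 A = (n : ℝ≥0∞)}
      = ⋃ n : ℕ, {ω : Configuration | ω.1 A = (n : ℝ≥0∞)} := by
    ext ω; simp
  have hone : μ {ω : Configuration | ∃ n : ℕ, ω.1 A = (n : ℝ≥0∞)} = 1 := by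
    rw [hset, measure_iUnion _ hm]
    · simp_rw [h.count A hA hΛ]
      rw [← measure_iUnion (fun i j hij => by simpa using hij) fun _ => .of_discrete,
        Set.iUnion_of_singleton, measure_univ]
    · intro i j hij
      refine Set.disjoint_left.2 fun ω hi hj => hij ?_
      have : (i : ℝ≥0∞) = j := (hi : ω.1 A = i).symm.trans hj
      exact_mod_cast this
  rw [ae_iff]
  have hms : MeasurableSet {ω : Configuration | ∃ n : ℕ, ω.1 A = (n : ℝ≥0∞)} := by
    rw [hset]; exact .iUnion hm
  exact (prob_compl_eq_zero_iff hms).2 hone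

theorem IsPoissonLaw.measure_count_gt_le (h : IsPoissonLaw μ Λ) {A : Set Obstacle}
    (hA : MeasurableSet A) (hΛ : Λ A ≠ ∞) :
    μ {ω | 3 * Λ A < ω.1 A} ≤ ENNReal.ofReal (Real.exp (-(Λ A).toReal)) := by
  refine le_trans ?_ (tsum_poisson_tail_le (Λ A).toNNReal)
  have hsub : {ω : Configuration | 3 * Λ A < ω.1 A} ≤ᵐ[μ]
      ⋃ n : ℕ, {ω : Configuration | 3 * ((Λ A).toNNReal : ℝ) < n ∧ ω.1 A = (n : ℝ≥0∞)} := by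
    filter_upwards [h.ae_exists_count_eq hA hΛ] with ω hω hlt
    obtain ⟨n, hn⟩ := hω
    refine Set.mem_iUnion.2 ⟨n, ?_, hn⟩
    change 3 * Λ A < ω.1 A at hlt
    rw [hn, ← ENNReal.coe_toNNReal hΛ] at hlt
    exact_mod_cast hlt
  refine (measure_mono_ae hsub).trans ((measure_iUnion_le _).trans ?_)
  refine ENNReal.tsum_le_tsum fun n => ?_
  split_ifs with hn
  · rw [← h.count A hA hΛ n]
    exact measure_mono fun ω hω => hω.2
  · simp [hn]

theorem IsPoissonLaw.ae_eq_zero (h : IsPoissonLaw μ Λ) {A : Set Obstacle}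
    (hA : MeasurableSet A) (hΛ : Λ A = 0) : ∀ᵐ ω ∂μ, ω.1 A = 0 := by
  have := h.isProbabilityMeasure
  have h1 := h.count A hA (by simp [hΛ]) 0
  rw [hΛ, poissonMeasure_singleton] at h1
  rw [ae_iff]
  refine (prob_compl_eq_zero_iff (measurable_count hA (measurableSet_singleton _))).2 ?_
  change μ {ω | ω.1 A = 0} = 1
  simpa using h1

end Poisson

/-! ### Almost sure sparseness of the background -/

section Intensity

variable {G : Measure ℝ} [IsProbabilityMeasure G] {φ : ℝ}

/-- The volume law has mass 1, so neither G nor φ appears; this makes K universal. -/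
theorem obstacleIntensity_ball (n : ℕ) :
    obstacleIntensity G φ {p | ‖p.1‖ ≤ n}
      = ENNReal.ofReal ((volume : Measure Space).real (Metric.closedBall 0 1) * n ^ 3) := by
  have : IsProbabilityMeasure (G.map fun v => φ * v) :=
    Measure.isProbabilityMeasure_map (by fun_prop)
  have hset : {p : Obstacle | ‖p.1‖ ≤ n} = Metric.closedBall (0 : Space) n ×ˢ Set.univ := by
    ext p; simp
  rw [obstacleIntensity, hset, Measure.prod_prod, measure_univ, mul_one,
    Measure.addHaar_closedBall _ _ (Nat.cast_nonneg n), mul_comm,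
    ENNReal.ofReal_mul measureReal_nonneg, ← Measure.addHaar_closedBall_eq_addHaar_ball,
    ofReal_measureReal (measure_closedBall_lt_top.ne)]
  simp

theorem obstacleIntensity_compl {v : ℝ} (hφ : 0 < φ) (hG : G (Set.Icc 0 v)ᶜ = 0) :
    obstacleIntensity G φ {p | p.2 ∈ Set.Icc 0 (φ * |v|)}ᶜ = 0 := by
  have : IsProbabilityMeasure (G.map fun v => φ * v) :=
    Measure.isProbabilityMeasure_map (by fun_prop)
  have hset : {p : Obstacle | p.2 ∈ Set.Icc 0 (φ * |v|)}ᶜ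
      = (Set.univ : Set Space) ×ˢ (Set.Icc 0 (φ * |v|))ᶜ := by
    ext p; simp
  rw [obstacleIntensity, hset, Measure.prod_prod,
    Measure.map_apply (by fun_prop) measurableSet_Icc.compl]
  refine mul_eq_zero_of_right _ (measure_mono_null ?_ hG)
  intro w hw hmem
  exact hw ⟨mul_nonneg hφ.le hmem.1,
    mul_le_mul_of_nonneg_left (hmem.2.trans (le_abs_self v)) hφ.le⟩

/-- Almost surely, the background is sparse, with a density constant that does not depend on the
law of the volumes. -/
theorem ae_sparse {μ : Measure Configuration} {v : ℝ} (hφ : 0 < φ) (hG : G (Set.Icc 0 v)ᶜ = 0)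
    (h : IsPoissonLaw μ (obstacleIntensity G φ)) :
    ∀ᵐ ω ∂μ, ∃ a : ℝ, 0 ≤ a ∧ Sparse ω.1 (φ * |v|)
      (3 * (volume : Measure Space).real (Metric.closedBall 0 1)) a := by
  set c := (volume : Measure Space).real (Metric.closedBall 0 1) with hc
  have hc0 : 0 < c :=
    ENNReal.toReal_pos (Metric.measure_closedBall_pos _ _ one_pos).ne'
      measure_closedBall_lt_top.ne
  have hA : ∀ n : ℕ, MeasurableSet {p : Obstacle | ‖p.1‖ ≤ n} := fun n =>
    measurableSet_le (by fun_prop) measurable_const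
  have hfin : ∀ n : ℕ, obstacleIntensity G φ {p | ‖p.1‖ ≤ n} ≠ ∞ := fun n => by
    rw [obstacleIntensity_ball]; exact ENNReal.ofReal_ne_top
  have hsummable : Summable fun n : ℕ => Real.exp (n * -c) :=
    Real.summable_exp_nat_mul_iff.2 (neg_lt_zero.2 hc0)
  have hBC : ∀ᵐ ω ∂μ, ∀ᶠ n : ℕ in Filter.atTop, ω ∉ {ω : Configuration |
      3 * obstacleIntensity G φ {p | ‖p.1‖ ≤ n} < ω.1 {p | ‖p.1‖ ≤ n}} := by
    -- Borel–Cantelli: the tails exp(−cn³) are at most exp(−cn), hence summable.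
    refine ae_eventually_notMem (ne_top_of_le_ne_top (hsummable.tsum_ofReal_ne_top) ?_)
    refine ENNReal.tsum_le_tsum fun n => (h.measure_count_gt_le (hA n) (hfin n)).trans ?_
    rw [obstacleIntensity_ball, ENNReal.toReal_ofReal (by positivity)]
    refine ENNReal.ofReal_le_ofReal (Real.exp_le_exp.2 ?_)
    have : (n : ℝ) ≤ n ^ 3 := by exact_mod_cast Nat.le_self_pow (by norm_num) n
    nlinarith
  have hvol := h.ae_eq_zero (A := {p | p.2 ∈ Set.Icc 0 (φ * |v|)}ᶜ)
    (measurable_snd measurableSet_Icc).compl (obstacleIntensity_compl hφ hG)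
  filter_upwards [hBC, hvol] with ω hω hv
  obtain ⟨N, hN⟩ := Filter.eventually_atTop.1 hω
  -- N shifts every radius into the range where the count bound holds; 1 pays for rounding R up.
  refine ⟨1 + N, by positivity, hv, fun R hR => ?_, fun A hA hne => ω.2.one_le hA hne⟩
  have hceil : R ≤ (⌈R⌉₊ + N : ℕ) := by
    push_cast
    have := Nat.le_ceil R
    have : (0 : ℝ) ≤ N := Nat.cast_nonneg N
    linarith
  have hsub : {p : Obstacle | ‖p.1‖ ≤ R} ⊆ {p | ‖p.1‖ ≤ (⌈R⌉₊ + N : ℕ)} :=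
    fun p (hp : ‖p.1‖ ≤ R) => hp.trans hceil
  refine (measure_mono hsub).trans
    ((not_lt.1 (hN (⌈R⌉₊ + N) (Nat.le_add_left _ _))).trans ?_)
  rw [obstacleIntensity_ball, ← ENNReal.ofReal_ofNat 3, ← ENNReal.ofReal_mul (by norm_num),
    ← mul_assoc]
  refine ENNReal.ofReal_le_ofReal (mul_le_mul_of_nonneg_left ?_ (by positivity))
  refine pow_le_pow_left₀ (by positivity) ?_ 3
  push_cast
  have := (Nat.ceil_lt_add_one hR).le
  linarith

end Intensity

end CTP

/-! ### The proposition -/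

theorem proposition5p1 (vstar : ℝ) :
    ∃ φstar : ℝ, 0 < φstar ∧
      ∀ G : MeasureTheory.Measure ℝ, MeasureTheory.IsProbabilityMeasure G →
        G (Set.Icc 0 vstar)ᶜ = 0 →
      ∀ φ : ℝ, 0 < φ → φ ≤ φstar →
      ∀ μ : MeasureTheory.Measure CTP.Configuration,
        CTP.IsPoissonLaw μ (CTP.obstacleIntensity G φ) →
      ∀ (Y₀ : CTP.Space) (V₀ : ℝ), 0 ≤ V₀ →
        ∃ Ωstar : Set CTP.Configuration, MeasurableSet Ωstar ∧ μ Ωstar = 1 ∧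
          ∀ ω ∈ Ωstar, ∀ (j : ℕ) (s : CTP.State),
            CTP.State.EventStart (CTP.initialState φ Y₀ V₀ ω) j s → s.stepCount < ⊤ := by
  set K : ℝ := 3 * (volume : Measure CTP.Space).real (Metric.closedBall 0 1)
  have hK : 0 ≤ K := by positivity
  have hσ := CTP.σ_nonneg
  set Q : ℝ := 4096 * |vstar| * K * CTP.σ ^ 3
  have hQ : 0 ≤ Q := by positivity
  -- The smallness condition reads φQ ≤ 1; Q + 1 avoids division by zero.
  refine ⟨1 / (Q + 1), by positivity, ?_⟩
  intro G hGprob hG φ hφ hφle μ hμ Y₀ V₀ hV₀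
  have := hμ.isProbabilityMeasure
  have hsmall : 4096 * (φ * |vstar|) * K * CTP.σ ^ 3 ≤ 1 := by
    have h1 := (le_div_iff₀ (by positivity)).1 hφle
    have h2 : 4096 * (φ * |vstar|) * K * CTP.σ ^ 3 = φ * Q := by simp only [Q]; ring
    linarith
  have hae := CTP.ae_sparse hφ hG hμ
  -- Removing a measurable null hull of the bad set spares proving that sparseness is a measurable
  -- event.
  refine ⟨(toMeasurable μ {ω | ¬ ∃ a : ℝ, 0 ≤ a ∧ CTP.Sparse ω.1 (φ * |vstar|) K a})ᶜ,
    (measurableSet_toMeasurable _ _).compl, ?_, ?_⟩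
  · rw [prob_compl_eq_one_iff (measurableSet_toMeasurable _ _), measure_toMeasurable]
    exact hae
  · intro ω hω j s hs
    obtain ⟨a, ha, hsp⟩ := not_not.1 fun hn => hω (subset_toMeasurable μ _ hn)
    obtain ⟨h1, h2⟩ := hs.sparse (s₀ := CTP.initialState φ Y₀ V₀ ω) hsp (mul_nonneg hφ.le hV₀)
    exact CTP.State.stepCount_lt_top h1 h2 (by positivity) hK ha hsmall
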